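/- All graphs are finite, simple, and have at least one vertex; $\mathbb{N}=\{1,2,3,\dots\}$. Write $\chi(G)$, $\omega(G)$, $\alpha(G)$ for the chromatic number, clique number and independence number of a graph $G$, $K_p$ for the complete graph on $p$ vertices, and $K_p\vee G$ for the join of vertex-disjoint copies of $K_p$ and $G$. A proper $m$-coloring of $G$ is a map from $V(G)$ to a set of $m$ colors that takes different values on adjacent vertices. The Hall ratio of $G$ is $\rho(G)=\max |V(H)|/\alpha(H)$, the maximum being over all subgraphs $H$ of $G$ with at least one vertex. For $k\in\mathbb{N}$, a $k$-assignment for $G$ is a map $L$ that assigns to each vertex $v$ a set $L(v)$ of exactly $k$ colors; a proper $L$-coloring is a proper coloring $f$ of $G$ with $f(v)\in L(v)$ for every vertex $v$; and a request of $L$ is a function $r$ with nonempty domain $D\subseteq V(G)$ such that $r(v)\in L(v)$ for every $v\in D$. For a real number $\epsilon\in[0,1]$, the graph $G$ is $(k,\epsilon)$-flexible if for every $k$-assignment $L$ for $G$ and every request $r$ of $L$, with domain $D$ say, there is a proper $L$-coloring $f$ of $G$ with $f(v)=r(v)$ for at least $\epsilon|D|$ vertices $v\in D$. The list flexibility number $\chi_{\ell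 flex}(G)$ is the smallest $k\in\mathbb{N}$ such that $G$ is $(k,1/\rho(G))$-flexible. Theorem. (1) For every graph $G$, the following are equivalent: (a) there is an $N\in\mathbb{N}$ such that $\chi_{\ell flex}(K_p\vee G)=\chi(K_p\vee G)$ for all $p\ge N$; (b) for every set $S\subseteq V(G)$ with $|S|=\omega(G)+1$ there are two distinct vertices $u,v\in S$ and a proper $\chi(G)$-coloring of $G$ that gives $u$ and $v$ the same color. (2) There is a graph $G$ for which no such $N$ exists; that is, for every $N\in\mathbb{N}$ there is a $p\ge N$ with $\chi_{\ell flex}(K_p\vee G)\ne\chi(K_p\vee G)$. -/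

import Mathlib

namespace FlexList

/-- The join `G ∨ H`: the disjoint union of `G` and `H` together with all edges between them. -/
def join {V W : Type*} (G : SimpleGraph V) (H : SimpleGraph W) : SimpleGraph (V ⊕ W) where
  Adj x y :=
    match x, y with
    | Sum.inl u, Sum.inl v => G.Adj u v
    | Sum.inr u, Sum.inr v => H.Adj u v
    | Sum.inl _, Sum.inr _ => True
    | Sum.inr _, Sum.inl _ => True
  symm := ⟨by
    rintro (u | u) (v | v) h
    · exact G.adj_symm h
    · trivial
    · trivial
    · exact H.adj_symm h⟩
  loopless := ⟨by
    rintro (u | u) h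
    · exact G.loopless.irrefl u h
    · exact H.loopless.irrefl u h⟩

/-- The Hall ratio `ρ(G)`: the maximum of `|V(H)| / α(H)` over the subgraphs `H` of `G` with at
least one vertex. For a finite nonempty graph, the supremum is over a finite nonempty set. -/
noncomputable def hallRatio {V : Type*} (G : SimpleGraph V) : ℝ :=
  sSup {x : ℝ | ∃ H : G.Subgraph, H.verts.Nonempty ∧
    x = (H.verts.ncard : ℝ) / (H.coe.indepNum : ℝ)}

/-- `L` is a `k`-assignment: every vertex gets a list of exactly `k` colours.
Colours are natural numbers. -/
def IsKAssignment {V : Type*} (k : ℕ) (L : V → Finset ℕ) : Prop :=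
  ∀ v, (L v).card = k

/-- `f` is a proper `L`-colouring of `G` (properness is part of `G.Coloring`). -/
def IsListColoring {V : Type*} {G : SimpleGraph V} (L : V → Finset ℕ) (f : G.Coloring ℕ) : Prop :=
  ∀ v, f v ∈ L v

/-- `r`, restricted to `D`, is a request of `L` with domain `D`; the values of `r` outside `D`
play no role. -/
def IsRequest {V : Type*} (L : V → Finset ℕ) (D : Finset V) (r : V → ℕ) : Prop :=
  D.Nonempty ∧ ∀ v ∈ D, r v ∈ L v

/-- `(G, L, r)` is `ε`-satisfiable, where `r` is a request with domain `D`: some proper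
`L`-colouring agrees with `r` on at least `ε |D|` vertices of `D`. -/
def IsSatisfiable {V : Type*} (G : SimpleGraph V) (L : V → Finset ℕ) (D : Finset V) (r : V → ℕ)
    (ε : ℝ) : Prop :=
  ∃ f : G.Coloring ℕ, IsListColoring L f ∧
    ε * (D.card : ℝ) ≤ ((D.filter fun v => f v = r v).card : ℝ)

/-- `G` is `(k, ε)`-flexible. -/
def IsFlexible {V : Type*} (G : SimpleGraph V) (k : ℕ) (ε : ℝ) : Prop :=
  ∀ L : V → Finset ℕ, IsKAssignment k L →
    ∀ (D : Finset V) (r : V → ℕ), IsRequest L D r → IsSatisfiable G L D r ε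

/-- The list flexibility number: the smallest positive integer `k` such that `G` is
`(k, 1 / ρ(G))`-flexible (and `⊤` if there is none). Positivity of `k` matters: for `k = 0` there
are no requests, so every graph would be `(0, ε)`-flexible vacuously. -/
noncomputable def listFlexNumber {V : Type*} (G : SimpleGraph V) : ℕ∞ :=
  ⨅ k ∈ {k : ℕ | 1 ≤ k ∧ IsFlexible G k (1 / hallRatio G)}, (k : ℕ∞)

/-- There is an `N` such that `χ_ℓflex(K_p ∨ G) = χ(K_p ∨ G)` for all `p ≥ N`. -/
def FlexOhba {V : Type*} (G : SimpleGraph V) : Prop :=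
  ∃ N : ℕ, 1 ≤ N ∧ ∀ p : ℕ, N ≤ p →
    listFlexNumber (join (⊤ : SimpleGraph (Fin p)) G) =
      (join (⊤ : SimpleGraph (Fin p)) G).chromaticNumber

end FlexList

namespace FlexList

/-! For large `p` the join has chromatic number `p + χ(G)` and Hall ratio `p + ω(G)`. A domain `D`
has at most `p + |V| ≤ 2(p + ω)` vertices, so flexibility asks for one satisfied request if `|D| ≤ p
+ ω` and two otherwise.

Necessity of (b): give all vertices the same list and request one colour on `K_p` together with `S`.
Two satisfied vertices are nonadjacent, hence both in `S`, and `G` has only `χ(G)` colours to use.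

Sufficiency: if `|D| > p + ω`, then `D` meets `K_p` in some `w` and contains more than `ω` vertices
of `G`, so (b) yields `u`, `v` in `D` sharing a class of a proper colouring. Either the request at
`w` differs from one at `u` or `v`, and those two are satisfied together, or all three agree and the
common class receives that colour. This rests on `exists_listColoring_class`: from lists of size `p
+ k`, a colour can be forced on a class of a `k`-colouring wherever it is available. Hall's theorem
peels off all vertices except a set whose lists have a small union, where the lists nearly coincide.

Part (2) splits the centre of the Grötzsch graph so that (b) fails. -/

/-! ### Systems of distinct representatives -/

theorem exists_injOn_of_hall {ι : Type*} (X : Finset ι) (t : ι → Finset ℕ)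
    (h : ∀ T ⊆ X, T.card ≤ (T.biUnion t).card) :
    ∃ f : ι → ℕ, Set.InjOn f X ∧ ∀ x ∈ X, f x ∈ t x := by
  classical
  obtain ⟨f, hf, hft⟩ := (Finset.all_card_le_biUnion_card_iff_exists_injective
    (fun x : X => t x)).1 (fun s => by
      have := h (s.map (Function.Embedding.subtype _)) (by
        intro x hx
        simp only [Finset.mem_map, Function.Embedding.coe_subtype] at hx
        obtain ⟨y, -, rfl⟩ := hx
        exact y.2)
      rw [Finset.card_map] at this
      refine this.trans (Finset.card_le_card ?_)
      intro a ha
      simp only [Finset.mem_biUnion, Finset.mem_map, Function.Embedding.coe_subtype] at ha ⊢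
      obtain ⟨x, ⟨y, hy, rfl⟩, hx⟩ := ha
      exact ⟨y, hy, hx⟩)
  refine ⟨fun x => if hx : x ∈ X then f ⟨x, hx⟩ else 0, ?_, ?_⟩
  · intro x hx y hy hxy
    have hx' : x ∈ X := hx
    have hy' : y ∈ X := hy
    simp only [hx', hy', dite_true] at hxy
    simpa using hf hxy
  · intro x hx
    simpa only [hx, dite_true] using hft ⟨x, hx⟩

/-- A system of distinct representatives exists off a set `S` on which the lists have a small
union, and it can be chosen outside that union. -/
theorem exists_small_pot {ι : Type*} [DecidableEq ι] (X : Finset ι) (t : ι → Finset ℕ) :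
    ∃ S ⊆ X, (S.biUnion t).card ≤ S.card ∧
      ∃ h : ι → ℕ, Set.InjOn h ↑(X \ S) ∧ ∀ x ∈ X \ S, h x ∈ t x ∧ h x ∉ S.biUnion t := by
  obtain ⟨S, hS, hmax⟩ := Finset.exists_max_image
    (X.powerset.filter fun S => (S.biUnion t).card ≤ S.card) Finset.card ⟨∅, by simp⟩
  simp only [Finset.mem_filter, Finset.mem_powerset] at hS hmax
  refine ⟨S, hS.1, hS.2, ?_⟩
  -- A set `T` violating Hall's condition for the reduced lists could be added to `S`, against
  -- maximality.
  obtain ⟨f, hf, hft⟩ := exists_injOn_of_hall (X \ S) (fun x => t x \ S.biUnion t) (by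
    intro T hT
    by_contra hcon
    push Not at hcon
    have hdisj : Disjoint S T := by
      rw [Finset.disjoint_right]
      intro x hx
      exact (Finset.mem_sdiff.1 (hT hx)).2
    have hsub : (S ∪ T).biUnion t ⊆ S.biUnion t ∪ T.biUnion fun x => t x \ S.biUnion t := by
      intro a ha
      by_cases haS : a ∈ S.biUnion t
      · exact Finset.mem_union_left _ haS
      · refine Finset.mem_union_right _ ?_
        simp only [Finset.mem_biUnion, Finset.mem_union] at ha
        obtain ⟨x, hx | hx, hax⟩ := ha
        · exact absurd (Finset.mem_biUnion.2 ⟨x, hx, hax⟩) haS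
        · exact Finset.mem_biUnion.2 ⟨x, hx, Finset.mem_sdiff.2 ⟨hax, haS⟩⟩
    have h1 := (Finset.card_le_card hsub).trans (Finset.card_union_le _ _)
    have h2 := Finset.card_union_of_disjoint hdisj
    have h3 := hmax (S ∪ T) ⟨Finset.union_subset hS.1 (hT.trans Finset.sdiff_subset), by omega⟩
    omega)
  exact ⟨f, hf, fun x hx => Finset.mem_sdiff.1 (hft x hx)⟩

/-- Lists of size at least `|P| - 1` have distinct representatives, unless they all coincide
and have exactly that size. -/
theorem exists_injOn_or_eq {ι : Type*} (P : Finset ι) (t : ι → Finset ℕ)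
    (h : ∀ x ∈ P, P.card ≤ (t x).card + 1) :
    (∃ f : ι → ℕ, Set.InjOn f P ∧ ∀ x ∈ P, f x ∈ t x) ∨
      ∃ Z : Finset ℕ, Z.card + 1 = P.card ∧ ∀ x ∈ P, t x = Z := by
  classical
  -- Only `P` itself can violate Hall's condition; if it does, the union is no larger than any
  -- single list.
  by_cases hP : P.card ≤ (P.biUnion t).card
  · left
    refine exists_injOn_of_hall P t fun T hT => ?_
    obtain rfl | hTP := eq_or_ne T P
    · exact hP
    obtain rfl | ⟨x, hx⟩ := T.eq_empty_or_nonempty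
    · simp
    have h1 := Finset.card_lt_card (hT.ssubset_of_ne hTP)
    have h2 := h x (hT hx)
    have h3 := Finset.card_le_card (Finset.subset_biUnion_of_mem t hx)
    omega
  · right
    push Not at hP
    have hne : P.Nonempty := by
      rw [Finset.nonempty_iff_ne_empty]
      rintro rfl
      simp at hP
    have key : ∀ x ∈ P, t x = P.biUnion t := fun x hx =>
      Finset.eq_of_subset_of_card_le (Finset.subset_biUnion_of_mem t hx) (by
        have := h x hx
        omega)
    obtain ⟨x, hx⟩ := hne
    refine ⟨P.biUnion t, ?_, key⟩
    have := h x hx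
    rw [key x hx] at this
    omega

theorem exists_injOn_of_card_le {ι : Type*} (P : Finset ι) (t : ι → Finset ℕ)
    (h : ∀ x ∈ P, P.card ≤ (t x).card) :
    ∃ f : ι → ℕ, Set.InjOn f P ∧ ∀ x ∈ P, f x ∈ t x := by
  obtain h' | ⟨Z, hZ, hP⟩ := exists_injOn_or_eq P t fun x hx => (h x hx).trans (Nat.le_succ _)
  · exact h'
  · obtain rfl | ⟨x, hx⟩ := P.eq_empty_or_nonempty
    · simp at hZ
    · have := h x hx
      rw [hP x hx] at this
      omega

/-! ### List colouring with a large set of distinctly coloured vertices -/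

/-- Injectivity on `P` settles all edges inside `P`, so the structure of `H` there never matters. -/
theorem exists_glue {W : Type*} (H : SimpleGraph W) (P Q : Finset W)
    (t : W → Finset ℕ) (a b : W → ℕ) (ha : Set.InjOn a P) (hat : ∀ x ∈ P, a x ∈ t x)
    (hb : ∀ u ∈ Q, ∀ v ∈ Q, H.Adj u v → b u ≠ b v) (hbt : ∀ v ∈ Q, b v ∈ t v)
    (hab : ∀ x ∈ P, ∀ v ∈ Q, a x ≠ b v) :
    ∃ f : W → ℕ, (∀ x, x ∈ P ∨ x ∈ Q → f x ∈ t x) ∧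
      ∀ x, x ∈ P ∨ x ∈ Q → ∀ y, y ∈ P ∨ y ∈ Q → H.Adj x y → f x ≠ f y := by
  classical
  refine ⟨fun x => if x ∈ P then a x else b x, ?_, ?_⟩
  · intro x hx
    by_cases hxP : x ∈ P
    · simpa [hxP] using hat x hxP
    · simpa [hxP] using hbt x (hx.resolve_left hxP)
  · intro x hx y hy hxy
    by_cases hxP : x ∈ P <;> by_cases hyP : y ∈ P <;> simp only [hxP, hyP, if_true, if_false]
    · exact fun h => hxy.ne (ha hxP hyP h)
    · exact hab x hxP y (hy.resolve_left hyP)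
    · exact (hab y hyP x (hx.resolve_left hxP)).symm
    · exact hb x (hx.resolve_left hxP) y (hy.resolve_left hyP) hxy

/-- If the lists together use few colours, then many colours are common to all vertices of `Q`. -/
theorem exists_common_colors {W : Type*} (P Q : Finset W) {k p q : ℕ} (hk : 0 < k)
    (t : W → Finset ℕ) (B : Finset ℕ) (hQ : Q.card ≤ q) (hp : q * q + 1 ≤ p)
    (hB : B.card ≤ p + q) (hne : ∃ x, x ∈ P ∨ x ∈ Q) (htB : ∀ x, x ∈ P ∨ x ∈ Q → t x ⊆ B)
    (ht : ∀ x, x ∈ P ∨ x ∈ Q → p + k ≤ (t x).card + 1) :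
    ∃ φ : Fin k → ℕ, Function.Injective φ ∧ ∀ v ∈ Q, ∀ i, φ i ∈ t v := by
  classical
  set C := B.filter fun a => ∀ v ∈ Q, a ∈ t v with hC
  have h1 : B \ C ⊆ Q.biUnion fun v => B \ t v := by
    intro a ha
    simp only [hC, Finset.mem_sdiff, Finset.mem_filter, not_and, not_forall] at ha
    obtain ⟨v, hv, hav⟩ := ha.2 ha.1
    exact Finset.mem_biUnion.2 ⟨v, hv, Finset.mem_sdiff.2 ⟨ha.1, hav⟩⟩
  have h2 : (B \ C).card ≤ Q.card * q := by
    refine (Finset.card_le_card h1).trans (Finset.card_biUnion_le_card_mul _ _ _ fun v hv => ?_)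
    have := Finset.card_sdiff_of_subset (htB v (Or.inr hv))
    have := ht v (Or.inr hv)
    omega
  have h3 : Q.card * q ≤ q * q := Nat.mul_le_mul_right _ hQ
  have h4 : (B \ C).card = B.card - C.card :=
    Finset.card_sdiff_of_subset (Finset.filter_subset _ _)
  obtain ⟨x, hx⟩ := hne
  have h5 := Finset.card_le_card (htB x hx)
  have h6 := ht x hx
  obtain ⟨φ⟩ := Function.Embedding.nonempty_of_card_le (α := Fin k) (β := C) (by
    rw [Fintype.card_fin, Fintype.card_coe]
    omega)
  exact ⟨fun i => φ i, fun i j hij => φ.injective (Subtype.ext hij),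
    fun v hv i => (Finset.mem_filter.1 (φ i).2).2 v hv⟩

/-- Common colours `φ i` serve the classes of `g`, and `P` is coloured from what remains, at least
`p - 1` colours per list. This fails only if all the remaining lists on `P` coincide; then the extra
colour guaranteed by `hi` moves class `i₀` off the colours of `P`, and `φ i₀` is released to `P`. -/
theorem exists_listColoring_of_small_pot {W : Type*} (H : SimpleGraph W) (P Q : Finset W)
    {k p q : ℕ} (g : W → Fin k) (hg : ∀ u ∈ Q, ∀ v ∈ Q, H.Adj u v → g u ≠ g v)
    (t : W → Finset ℕ) (i₀ : Fin k) (B : Finset ℕ) (hP : P.card ≤ p) (hQ : Q.card ≤ q)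
    (hp : q * q + 1 ≤ p) (hB : B.card ≤ p + q) (htB : ∀ x, x ∈ P ∨ x ∈ Q → t x ⊆ B)
    (ht : ∀ x, x ∈ P ∨ x ∈ Q → p + k ≤ (t x).card + 1)
    (hi : ∀ v ∈ Q, g v = i₀ → p + k ≤ (t v).card) :
    ∃ f : W → ℕ, (∀ x, x ∈ P ∨ x ∈ Q → f x ∈ t x) ∧
      ∀ x, x ∈ P ∨ x ∈ Q → ∀ y, y ∈ P ∨ y ∈ Q → H.Adj x y → f x ≠ f y := by
  classical
  by_cases hne : ∃ x, x ∈ P ∨ x ∈ Q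
  swap
  · push Not at hne
    exact ⟨fun _ => 0, fun x hx => absurd hx (not_or.2 (hne x)),
      fun x hx => absurd hx (not_or.2 (hne x))⟩
  have hk : 0 < k := i₀.pos
  obtain ⟨φ, hφ, hφt⟩ := exists_common_colors P Q hk t B hQ hp hB hne htB ht
  set F : Finset ℕ := Finset.univ.image φ with hF
  have hFcard : F.card = k := by
    rw [hF, Finset.card_image_of_injective _ hφ, Finset.card_univ, Fintype.card_fin]
  have hφF : ∀ i, φ i ∈ F := fun i => Finset.mem_image_of_mem _ (Finset.mem_univ i)
  obtain ⟨a, ha, hat⟩ | ⟨Z, hZ, hPZ⟩ := exists_injOn_or_eq P (fun x => t x \ F) (fun x hx => by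
    have := Finset.le_card_sdiff F (t x)
    have := ht x (Or.inl hx)
    omega)
  · refine exists_glue H P Q t a (fun v => φ (g v)) ha
      (fun x hx => (Finset.mem_sdiff.1 (hat x hx)).1)
      (fun u hu v hv huv h => hg u hu v hv huv (hφ h)) (fun v hv => hφt v hv _) ?_
    intro x hx v hv h
    exact (Finset.mem_sdiff.1 (hat x hx)).2 (h ▸ hφF _)
  · -- All lists on `P` lie in `Z ∪ F`, which leaves a free colour for the class `i₀`.
    have hY : ∀ x ∈ P, t x ⊆ Z ∪ F := by
      intro x hx
      rw [← hPZ x hx]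
      exact fun y hy => by
        by_cases hyF : y ∈ F <;> simp [hy, hyF]
    have hfree : ∀ v, ∃ e, v ∈ Q → g v = i₀ → e ∈ t v ∧ e ∉ Z ∪ F := by
      intro v
      by_cases hv : v ∈ Q ∧ g v = i₀
      · have h1 := hi v hv.1 hv.2
        have h2 := Finset.card_union_le Z F
        obtain ⟨e, he, he'⟩ := Finset.exists_mem_notMem_of_card_lt_card
          (s := Z ∪ F) (t := t v) (by omega)
        exact ⟨e, fun _ _ => ⟨he, he'⟩⟩
      · exact ⟨0, fun h1 h2 => absurd ⟨h1, h2⟩ hv⟩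
    choose e he using hfree
    -- Withholding only `k - 1` colours leaves each list on `P` at least `p` colours.
    set F' : Finset ℕ := F.erase (φ i₀) with hF'
    have hF'card : F'.card = k - 1 := by
      rw [hF', Finset.card_erase_of_mem (hφF _), hFcard]
    obtain ⟨a, ha, hat⟩ := exists_injOn_of_card_le P (fun x => t x \ F') (fun x hx => by
      have := Finset.le_card_sdiff F' (t x)
      have := ht x (Or.inl hx)
      omega)
    refine exists_glue H P Q t a (fun v => if g v = i₀ then e v else φ (g v)) ha
      (fun x hx => (Finset.mem_sdiff.1 (hat x hx)).1) ?_ ?_ ?_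
    · intro u hu v hv huv
      have hne := hg u hu v hv huv
      by_cases h1 : g u = i₀ <;> by_cases h2 : g v = i₀ <;> simp only [h1, h2, if_true, if_false]
      · exact absurd (h1.trans h2.symm) hne
      · exact fun h => (he u hu h1).2 (h ▸ Finset.mem_union_right _ (hφF _))
      · exact fun h => (he v hv h2).2 (h ▸ Finset.mem_union_right _ (hφF _))
      · exact fun h => hne (hφ h)
    · intro v hv
      by_cases h1 : g v = i₀
      · simpa [h1] using (he v hv h1).1
      · simpa [h1] using hφt v hv _
    · intro x hx v hv
      have hax := Finset.mem_sdiff.1 (hat x hx)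
      by_cases h1 : g v = i₀ <;> simp only [h1, if_true, if_false]
      · exact fun h => (he v hv h1).2 (h ▸ hY x hx hax.1)
      · exact fun h => hax.2 (h ▸ Finset.mem_erase.2 ⟨fun h' => h1 (hφ h'), hφF _⟩)

/-- If `g` is a proper `k`-colouring of `Q` and `P` is large, then from lists of size `|P| + k`
one can colour `P ∪ Q` properly, giving a prescribed colour `c` to every vertex of a prescribed
class of `g` that has `c` in its list. -/
theorem exists_listColoring_class {W : Type*} (H : SimpleGraph W) (P Q : Finset W)
    (hPQ : Disjoint P Q) {k : ℕ} (g : W → Fin k)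
    (hg : ∀ u ∈ Q, ∀ v ∈ Q, H.Adj u v → g u ≠ g v) (L : W → Finset ℕ) (i₀ : Fin k) (c : ℕ)
    (hp : Q.card * Q.card + 1 ≤ P.card)
    (hL : ∀ x, x ∈ P ∨ x ∈ Q → P.card + k ≤ (L x).card) :
    ∃ f : W → ℕ, (∀ x, x ∈ P ∨ x ∈ Q → f x ∈ L x) ∧
      (∀ x, x ∈ P ∨ x ∈ Q → ∀ y, y ∈ P ∨ y ∈ Q → H.Adj x y → f x ≠ f y) ∧
      ∀ u ∈ Q, g u = i₀ → c ∈ L u → f u = c := by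
  classical
  -- `U` is to be coloured `c`, and `c` is removed from every other list.
  set U := Q.filter fun u => g u = i₀ ∧ c ∈ L u with hU
  obtain ⟨S, hSX, hScard, h, hinj, hh⟩ := exists_small_pot (P ∪ (Q \ U)) (fun x => (L x).erase c)
  set B := S.biUnion fun x => (L x).erase c with hB
  have hSPQ : ∀ x ∈ S, x ∈ P ∨ (x ∈ Q ∧ x ∉ U) := fun x hx => by
    simpa using hSX hx
  have hSc : S.card ≤ P.card + Q.card :=
    (Finset.card_le_card hSX).trans ((Finset.card_union_le _ _).trans
      (Nat.add_le_add_left (Finset.card_le_card Finset.sdiff_subset) _))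
  obtain ⟨ψ, hψt, hψ⟩ := exists_listColoring_of_small_pot H (S ∩ P) (S ∩ Q) (p := P.card)
    (q := Q.card) g
    (fun u hu v hv => hg u (Finset.mem_inter.1 hu).2 v (Finset.mem_inter.1 hv).2)
    (fun x => (L x).erase c) i₀ B (Finset.card_le_card Finset.inter_subset_right)
    (Finset.card_le_card Finset.inter_subset_right) hp (hScard.trans hSc)
    (fun x hx => Finset.subset_biUnion_of_mem (fun x => (L x).erase c) (by
      simp only [Finset.mem_inter] at hx
      tauto))
    (fun x hx => by
      have := hL x (by
        simp only [Finset.mem_inter] at hx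
        tauto)
      have := Finset.pred_card_le_card_erase (s := L x) (a := c)
      omega)
    -- A vertex of class `i₀` outside `U` lacks `c`, so its list keeps full size.
    (fun v hv hvi => by
      rw [Finset.mem_inter] at hv
      have hvU : v ∉ U := by
        rcases hSPQ v hv.1 with h | h
        · exact absurd hv.2 (Finset.disjoint_left.1 hPQ h)
        · exact h.2
      have hcv : c ∉ L v := fun hc => hvU (Finset.mem_filter.2 ⟨hv.2, hvi, hc⟩)
      rw [Finset.erase_eq_of_notMem hcv]
      exact hL v (Or.inr hv.2))
  have hmem : ∀ x ∈ S, x ∈ S ∩ P ∨ x ∈ S ∩ Q := fun x hx => by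
    have := hSPQ x hx
    simp only [Finset.mem_inter]
    tauto
  have hT : ∀ x, x ∈ P ∨ x ∈ Q → x ∉ U → x ∉ S → x ∈ (P ∪ (Q \ U)) \ S := fun x hx hxU hxS => by
    simp only [Finset.mem_sdiff, Finset.mem_union]
    tauto
  have hψB : ∀ x ∈ S, ψ x ∈ B := fun x hx =>
    Finset.mem_biUnion.2 ⟨x, hx, hψt x (hmem x hx)⟩
  have hUc : ∀ x ∈ U, ∀ y ∈ U, ¬ H.Adj x y := fun x hx y hy hxy => by
    simp only [hU, Finset.mem_filter] at hx hy
    exact hg x hx.1 y hy.1 hxy (hx.2.1.trans hy.2.1.symm)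
  refine ⟨fun x => if x ∈ U then c else if x ∈ S then ψ x else h x, ?_, ?_, ?_⟩
  · intro x hx
    by_cases hxU : x ∈ U
    · simpa [hxU] using (Finset.mem_filter.1 hxU).2.2
    by_cases hxS : x ∈ S
    · simpa [hxU, hxS] using Finset.mem_of_mem_erase (hψt x (hmem x hxS))
    · simpa [hxU, hxS] using Finset.mem_of_mem_erase (hh x (hT x hx hxU hxS)).1
  · have hnc : ∀ x, x ∈ P ∨ x ∈ Q → x ∉ U → (if x ∈ S then ψ x else h x) ≠ c := by
      intro x hx hxU
      by_cases hxS : x ∈ S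
      · simpa [hxS] using Finset.ne_of_mem_erase (hψt x (hmem x hxS))
      · simpa [hxS] using Finset.ne_of_mem_erase (hh x (hT x hx hxU hxS)).1
    intro x hx y hy hxy
    by_cases hxU : x ∈ U <;> by_cases hyU : y ∈ U <;> simp only [hxU, hyU, if_true, if_false]
    · exact absurd hxy (hUc x hxU y hyU)
    · exact (hnc y hy hyU).symm
    · exact hnc x hx hxU
    · by_cases hxS : x ∈ S <;> by_cases hyS : y ∈ S <;> simp only [hxS, hyS, if_true, if_false]
      · exact hψ x (hmem x hxS) y (hmem y hyS) hxy
      · exact fun e => (hh y (hT y hy hyU hyS)).2 (e ▸ hψB x hxS)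
      · exact fun e => (hh x (hT x hx hxU hxS)).2 (e.symm ▸ hψB y hyS)
      · exact fun e => hxy.ne (hinj (hT x hx hxU hxS) (hT y hy hyU hyS) e)
  · intro u hu hui huc
    have : u ∈ U := Finset.mem_filter.2 ⟨hu, hui, huc⟩
    simp [this]

/-- As `exists_listColoring_class`, with prescribed distinct colours on a set `R ⊆ P`. -/
theorem exists_listColoring_prescribed {W : Type*} (H : SimpleGraph W) (P Q R : Finset W)
    (hPQ : Disjoint P Q) (hRP : R ⊆ P) {k : ℕ} (g : W → Fin k)
    (hg : ∀ u ∈ Q, ∀ v ∈ Q, H.Adj u v → g u ≠ g v) (L : W → Finset ℕ) (i₀ : Fin k) (c : ℕ)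
    (hp : Q.card * Q.card + 1 + R.card ≤ P.card)
    (hL : ∀ x, x ∈ P ∨ x ∈ Q → P.card + k ≤ (L x).card)
    (r : W → ℕ) (hr : Set.InjOn r R) (hrL : ∀ x ∈ R, r x ∈ L x) :
    ∃ f : W → ℕ, (∀ x, x ∈ P ∨ x ∈ Q → f x ∈ L x) ∧
      (∀ x, x ∈ P ∨ x ∈ Q → ∀ y, y ∈ P ∨ y ∈ Q → H.Adj x y → f x ≠ f y) ∧
      (∀ x ∈ R, f x = r x) ∧
      ∀ u ∈ Q, g u = i₀ → c ∈ L u → (∀ x ∈ R, r x ≠ c) → f u = c := by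
  classical
  have hcard : (P \ R).card = P.card - R.card := Finset.card_sdiff_of_subset hRP
  -- Fixing `R` removes `|R|` vertices and at most `|R|` colours per list, so the required list size
  -- survives.
  obtain ⟨f, hfL, hf, hfc⟩ := exists_listColoring_class H (P \ R) Q
    (hPQ.mono_left Finset.sdiff_subset) g hg (fun x => L x \ R.image r) i₀ c (by omega)
    (fun x hx => by
      have h1 := hL x (by
        rw [Finset.mem_sdiff] at hx
        tauto)
      have h2 := Finset.le_card_sdiff (R.image r) (L x)
      have h3 : (R.image r).card ≤ R.card := Finset.card_image_le
      omega)
  have hcase : ∀ x, x ∈ P ∨ x ∈ Q → x ∉ R → x ∈ P \ R ∨ x ∈ Q := fun x hx hxR => by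
    rw [Finset.mem_sdiff]
    tauto
  have hfr : ∀ x, x ∈ P ∨ x ∈ Q → x ∉ R → ∀ y ∈ R, f x ≠ r y := fun x hx hxR y hy h =>
    (Finset.mem_sdiff.1 (hfL x (hcase x hx hxR))).2 (h ▸ Finset.mem_image_of_mem r hy)
  refine ⟨fun x => if x ∈ R then r x else f x, ?_, ?_, ?_, ?_⟩
  · intro x hx
    by_cases hxR : x ∈ R
    · simpa [hxR] using hrL x hxR
    · simpa [hxR] using (Finset.mem_sdiff.1 (hfL x (hcase x hx hxR))).1
  · intro x hx y hy hxy
    by_cases hxR : x ∈ R <;> by_cases hyR : y ∈ R <;> simp only [hxR, hyR, if_true, if_false]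
    · exact fun h => hxy.ne (hr hxR hyR h)
    · exact (hfr y hy hyR x hxR).symm
    · exact hfr x hx hxR y hyR
    · exact hf x (hcase x hx hxR) y (hcase y hy hyR) hxy
  · intro x hx
    simp [hx]
  · intro u hu hui huc hRc
    have huR : u ∉ R := fun h => Finset.disjoint_left.1 hPQ (hRP h) hu
    simp only [huR, if_false]
    refine hfc u hu hui (Finset.mem_sdiff.2 ⟨huc, fun h => ?_⟩)
    obtain ⟨x, hx, hxc⟩ := Finset.mem_image.1 h
    exact hRc x hx hxc

/-! ### Joins with a complete graph -/

section Join

variable {V : Type*} {p : ℕ}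

@[simp] theorem join_adj_inr_inr {U : Type*} {F : SimpleGraph U} {G : SimpleGraph V} {u v : V} :
    (join F G).Adj (Sum.inr u) (Sum.inr v) ↔ G.Adj u v := Iff.rfl

@[simp] theorem join_adj_inl_inl {U : Type*} {F : SimpleGraph U} {G : SimpleGraph V} {u v : U} :
    (join F G).Adj (Sum.inl u) (Sum.inl v) ↔ F.Adj u v := Iff.rfl

theorem join_adj_inl_inr {U : Type*} {F : SimpleGraph U} {G : SimpleGraph V} (u : U) (v : V) :
    (join F G).Adj (Sum.inl u) (Sum.inr v) := trivial

theorem exists_join_listColoring [Fintype V] (G : SimpleGraph V) {k : ℕ}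
    (g : G.Coloring (Fin k)) (L : Fin p ⊕ V → Finset ℕ) (hL : IsKAssignment (p + k) L)
    (i₀ : Fin k) (c : ℕ) (R : Finset (Fin p))
    (hp : Fintype.card V * Fintype.card V + 1 + R.card ≤ p) (r : Fin p ⊕ V → ℕ)
    (hr : Set.InjOn (fun x => r (Sum.inl x)) R) (hrL : ∀ x ∈ R, r (Sum.inl x) ∈ L (Sum.inl x)) :
    ∃ f : (join (⊤ : SimpleGraph (Fin p)) G).Coloring ℕ, IsListColoring L f ∧
      (∀ x ∈ R, f (Sum.inl x) = r (Sum.inl x)) ∧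
      ∀ u, g u = i₀ → c ∈ L (Sum.inr u) → (∀ x ∈ R, r (Sum.inl x) ≠ c) → f (Sum.inr u) = c := by
  classical
  have hall : ∀ x : Fin p ⊕ V, x ∈ Finset.univ.map Function.Embedding.inl ∨
      x ∈ Finset.univ.map Function.Embedding.inr := by
    rintro (x | x) <;> simp
  obtain ⟨f, hfL, hf, hfr, hfc⟩ := exists_listColoring_prescribed
    (join (⊤ : SimpleGraph (Fin p)) G) (Finset.univ.map Function.Embedding.inl)
    (Finset.univ.map Function.Embedding.inr) (R.map Function.Embedding.inl)
    (by
      rw [Finset.disjoint_left]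
      rintro (x | x) <;> simp)
    (Finset.map_subset_map.2 (Finset.subset_univ R)) (Sum.elim (fun _ => i₀) g)
    (by
      simp only [Finset.mem_map, Finset.mem_univ, true_and, Function.Embedding.inr_apply]
      rintro _ ⟨u, rfl⟩ _ ⟨v, rfl⟩ huv
      exact g.valid huv)
    L i₀ c (by simpa using hp) (fun x _ => by simp [hL x]) r
    (by
      rintro x hx y hy hxy
      simp only [Finset.coe_map, Function.Embedding.inl_apply, Set.mem_image] at hx hy
      obtain ⟨x, hx, rfl⟩ := hx
      obtain ⟨y, hy, rfl⟩ := hy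
      rw [hr hx hy hxy])
    (by
      simpa using hrL)
  refine ⟨SimpleGraph.Coloring.mk f fun {x y} hxy => hf x (hall x) y (hall y) hxy,
    fun x => hfL x (hall x), fun x hx => hfr _ (Finset.mem_map_of_mem _ hx), ?_⟩
  intro u hu huc hRc
  refine hfc (Sum.inr u) (Finset.mem_map_of_mem _ (Finset.mem_univ u)) hu huc ?_
  simpa using hRc

/-- A colouring of `K_p ∨ G` from a set `A` of colours leaves `|A| - p` colours for `G`. -/
theorem exists_coloring_of_join (G : SimpleGraph V) {α : Type*}
    (f : (join (⊤ : SimpleGraph (Fin p)) G).Coloring α) (A : Finset α) (hf : ∀ x, f x ∈ A) :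
    p ≤ A.card ∧ ∃ c : G.Coloring (Fin (A.card - p)),
      ∀ u v, c u = c v ↔ f (Sum.inr u) = f (Sum.inr v) := by
  classical
  have hinj : Function.Injective fun x : Fin p => f (Sum.inl x) := by
    intro x y hxy
    by_contra hne
    exact f.valid (v := Sum.inl x) (w := Sum.inl y) (by simpa using hne) hxy
  set A' : Finset α := Finset.univ.image fun x : Fin p => f (Sum.inl x) with hA'
  have hA'card : A'.card = p := by
    rw [hA', Finset.card_image_of_injective _ hinj, Finset.card_univ, Fintype.card_fin]
  have hsub : A' ⊆ A := by
    intro a ha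
    obtain ⟨x, -, rfl⟩ := Finset.mem_image.1 ha
    exact hf _
  have hcard : (A \ A').card = A.card - p := by
    rw [Finset.card_sdiff_of_subset hsub, hA'card]
  refine ⟨hA'card ▸ Finset.card_le_card hsub, ?_⟩
  have hmem : ∀ u : V, f (Sum.inr u) ∈ A \ A' := fun u => Finset.mem_sdiff.2 ⟨hf _, fun h => by
    obtain ⟨x, -, hx⟩ := Finset.mem_image.1 h
    exact f.valid (join_adj_inl_inr x u) hx⟩
  have hiff : ∀ u v : V, (A \ A').equivFinOfCardEq hcard ⟨f (Sum.inr u), hmem u⟩ =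
      (A \ A').equivFinOfCardEq hcard ⟨f (Sum.inr v), hmem v⟩ ↔ f (Sum.inr u) = f (Sum.inr v) :=
    fun u v => by
      rw [EmbeddingLike.apply_eq_iff_eq, Subtype.mk.injEq]
  exact ⟨SimpleGraph.Coloring.mk
    (fun u => (A \ A').equivFinOfCardEq hcard ⟨f (Sum.inr u), hmem u⟩)
    fun {u v} huv h => f.valid (join_adj_inr_inr.2 huv) ((hiff u v).1 h), hiff⟩

theorem join_colorable {G : SimpleGraph V} {k : ℕ} (h : G.Colorable k) :
    (join (⊤ : SimpleGraph (Fin p)) G).Colorable (p + k) := by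
  obtain ⟨g⟩ := h
  refine ⟨SimpleGraph.Coloring.mk
    (Sum.elim (fun x => Fin.castAdd k x) fun v => Fin.natAdd p (g v)) ?_⟩
  rintro (u | u) (v | v) huv h
  · exact huv (Fin.castAdd_injective _ _ h)
  · have := congrArg Fin.val h
    have := u.2
    simp at *
    omega
  · have := congrArg Fin.val h
    have := v.2
    simp at *
    omega
  · exact g.valid huv (Fin.natAdd_injective _ _ h)

theorem chromaticNumber_join [Finite V] (G : SimpleGraph V) :
    (join (⊤ : SimpleGraph (Fin p)) G).chromaticNumber =
      ((p + G.chromaticNumber.toNat : ℕ) : ℕ∞) := by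
  have hG : G.Colorable G.chromaticNumber.toNat :=
    G.colorable_chromaticNumber_of_fintype
  refine le_antisymm (join_colorable hG).chromaticNumber_le ?_
  refine le_iInf₂ fun m hm => ?_
  obtain ⟨f⟩ := hm
  obtain ⟨h1, c, -⟩ := exists_coloring_of_join G f Finset.univ fun _ => Finset.mem_univ _
  rw [Finset.card_univ, Fintype.card_fin] at h1 c
  have h2 : G.chromaticNumber ≤ ((m - p : ℕ) : ℕ∞) :=
    SimpleGraph.Colorable.chromaticNumber_le ⟨c⟩
  have h3 : G.chromaticNumber.toNat ≤ m - p :=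
    ENat.toNat_le_of_le_natCast h2
  exact_mod_cast (by omega : p + G.chromaticNumber.toNat ≤ m)

/-! ### The Hall ratio -/

/-- If the independence number is at least 2, the ratio is at most `(p + |V|)/2 ≤ p`. If it is 1,
the vertices form a clique. -/
theorem ncard_verts_div_indepNum_le [Fintype V] (G : SimpleGraph V)
    (hp : Fintype.card V ≤ p) (H : (join (⊤ : SimpleGraph (Fin p)) G).Subgraph)
    (hH : H.verts.Nonempty) :
    (H.verts.ncard : ℝ) / (H.coe.indepNum : ℝ) ≤ ((p + G.cliqueNum : ℕ) : ℝ) := by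
  classical
  obtain ⟨x, hx⟩ := hH
  have h1 : 1 ≤ H.coe.indepNum :=
    SimpleGraph.IsIndepSet.card_le_indepNum (t := {⟨x, hx⟩}) (by simp [SimpleGraph.IsIndepSet])
  have h1' : (1 : ℝ) ≤ H.coe.indepNum := by exact_mod_cast h1
  rw [div_le_iff₀ (by linarith)]
  obtain h2 | h2 : 2 ≤ H.coe.indepNum ∨ H.coe.indepNum = 1 := by omega
  · have h3 : H.verts.ncard ≤ p + Fintype.card V := by
      refine (Set.ncard_le_card H.verts).trans ?_
      simp
    have h4 : p + Fintype.card V ≤ (p + G.cliqueNum) * H.coe.indepNum :=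
      (by omega : p + Fintype.card V ≤ (p + G.cliqueNum) * 2).trans (Nat.mul_le_mul_left _ h2)
    exact_mod_cast h3.trans h4
  · have hadj : ∀ u ∈ H.verts, ∀ v ∈ H.verts, u ≠ v →
        (join (⊤ : SimpleGraph (Fin p)) G).Adj u v := by
      intro u hu v hv huv
      by_contra hcon
      have h3 : ({⟨u, hu⟩, ⟨v, hv⟩} : Finset H.verts).card ≤ H.coe.indepNum :=
        SimpleGraph.IsIndepSet.card_le_indepNum (by
          rw [Finset.coe_pair]
          rintro a (rfl | rfl) b (rfl | rfl) hab h
          · exact hab rfl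
          · exact hcon (H.adj_sub h)
          · exact hcon (H.adj_sub h).symm
          · exact hab rfl)
      rw [Finset.card_pair (by simpa using huv)] at h3
      omega
    have h3 : H.verts.toFinset.card ≤ p + G.cliqueNum := by
      rw [← Finset.card_toLeft_add_card_toRight]
      refine Nat.add_le_add ?_ ?_
      · simpa using Finset.card_le_univ H.verts.toFinset.toLeft
      · refine SimpleGraph.IsClique.card_le_cliqueNum (tc := fun u hu v hv huv => ?_)
        exact join_adj_inr_inr.1 (hadj (Sum.inr u) (by simpa using hu) (Sum.inr v)
          (by simpa using hv) (by simpa using huv))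
    rw [h2, Set.ncard_eq_toFinset_card']
    simpa using (by exact_mod_cast h3 : (H.verts.toFinset.card : ℝ) ≤ ((p + G.cliqueNum : ℕ) : ℝ))

theorem hallRatio_join [Fintype V] (G : SimpleGraph V) (hp : Fintype.card V ≤ p) (hp0 : 0 < p) :
    hallRatio (join (⊤ : SimpleGraph (Fin p)) G) = ((p + G.cliqueNum : ℕ) : ℝ) := by
  classical
  refine IsGreatest.csSup_eq ⟨?_, ?_⟩
  · obtain ⟨s, hs⟩ := G.exists_isNClique_cliqueNum
    -- The extremal subgraph is `K_p` joined to a maximum clique of `G`.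
    set T : Finset (Fin p ⊕ V) := Finset.univ.disjSum s with hT
    have hTcard : T.card = p + G.cliqueNum := by
      rw [hT, Finset.card_disjSum, Finset.card_univ, Fintype.card_fin, hs.card_eq]
    have hTne : (⟨0, hp0⟩ : Fin p) ∈ (Finset.univ : Finset (Fin p)) := Finset.mem_univ _
    have hadj : ∀ x ∈ T, ∀ y ∈ T, x ≠ y → (join (⊤ : SimpleGraph (Fin p)) G).Adj x y := by
      rintro (x | x) hx (y | y) hy hxy
      · simpa using hxy
      · exact join_adj_inl_inr x y
      · exact (join_adj_inl_inr y x).symm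
      · exact hs.isClique (by simpa [hT] using hx) (by simpa [hT] using hy) (by simpa using hxy)
    set H : (join (⊤ : SimpleGraph (Fin p)) G).Subgraph := (⊤ : SimpleGraph.Subgraph _).induce T
    have hHv : H.verts = T := rfl
    have hx0 : (Sum.inl ⟨0, hp0⟩ : Fin p ⊕ V) ∈ H.verts := by simp [hHv, hT]
    have hind : H.coe.indepNum = 1 := by
      refine le_antisymm ?_ ?_
      · obtain ⟨t, ht⟩ := H.coe.exists_isNIndepSet_indepNum
        rw [← ht.card_eq, Finset.card_le_one]
        intro a ha b hb
        by_contra hab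
        have hne : a.1 ≠ b.1 := fun h => hab (Subtype.ext h)
        have h1 : a.1 ∈ T := a.2
        have h2 : b.1 ∈ T := b.2
        exact ht.isIndepSet ha hb hab ⟨h1, h2, hadj _ h1 _ h2 hne⟩
      · exact SimpleGraph.IsIndepSet.card_le_indepNum (t := {⟨_, hx0⟩})
          (by simp [SimpleGraph.IsIndepSet])
    refine ⟨H, ⟨_, hx0⟩, ?_⟩
    rw [hind, hHv, Set.ncard_coe_finset, hTcard]
    simp
  · rintro _ ⟨H, hH, rfl⟩
    exact ncard_verts_div_indepNum_le G hp H hH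

end Join

/-! ### Flexibility of the join and condition (b) -/

/-- Identical lists turn a list colouring into an ordinary one; a one-vertex request is made only
because domains must be nonempty. -/
theorem le_of_isFlexible {W : Type*} [Nonempty W] {G : SimpleGraph W} {k : ℕ} {ε : ℝ}
    (hk : 1 ≤ k) (h : IsFlexible G k ε) : G.chromaticNumber ≤ k := by
  classical
  obtain ⟨x⟩ := ‹Nonempty W›
  obtain ⟨f, hf, -⟩ := h (fun _ => Finset.range k) (fun _ => Finset.card_range k) {x} (fun _ => 0)
    ⟨Finset.singleton_nonempty x, fun _ _ => Finset.mem_range.2 hk⟩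
  exact SimpleGraph.Colorable.chromaticNumber_le ⟨SimpleGraph.Coloring.mk
    (fun v => (⟨f v, Finset.mem_range.1 (hf v)⟩ : Fin k))
    fun {u v} huv h => f.valid huv (congrArg Fin.val h)⟩

theorem listFlexNumber_eq_chromaticNumber_iff {W : Type*} [Nonempty W] {G : SimpleGraph W} {k : ℕ}
    (hk : 1 ≤ k) (hG : G.chromaticNumber = k) :
    listFlexNumber G = G.chromaticNumber ↔ IsFlexible G k (1 / hallRatio G) := by
  constructor
  · intro h
    by_contra hcon
    have h1 : ((k + 1 : ℕ) : ℕ∞) ≤ listFlexNumber G := by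
      refine le_iInf₂ fun m hm => ?_
      have h2 := le_of_isFlexible hm.1 hm.2
      rw [hG, Nat.cast_le] at h2
      rw [Nat.cast_le]
      refine Nat.lt_of_le_of_ne h2 ?_
      rintro rfl
      exact hcon hm.2
    rw [h, hG, Nat.cast_le] at h1
    omega
  · intro h
    refine le_antisymm ?_ (le_iInf₂ fun m hm => le_of_isFlexible hm.1 hm.2)
    rw [hG]
    exact iInf₂_le k ⟨hk, h⟩

variable {V : Type*} {p : ℕ}

theorem isSatisfiable_of_filter_card {W : Type*} {G : SimpleGraph W} {L : W → Finset ℕ}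
    {D : Finset W} {r : W → ℕ} {m : ℕ} {a : ℕ} (hm : 0 < m) (hD : D.card ≤ a * m)
    (f : G.Coloring ℕ) (hf : IsListColoring L f)
    (ha : a ≤ (D.filter fun v => f v = r v).card) :
    IsSatisfiable G L D r (1 / (m : ℝ)) := by
  refine ⟨f, hf, ?_⟩
  have hm' : (0 : ℝ) < m := by exact_mod_cast hm
  rw [one_div_mul_eq_div, div_le_iff₀ hm']
  exact_mod_cast hD.trans (Nat.mul_le_mul_right m ha)

theorem two_le_card_filter {W : Type*} {D : Finset W} {q : W → Prop} [DecidablePred q] {x y : W}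
    (hx : x ∈ D) (hy : y ∈ D) (hxy : x ≠ y) (hqx : q x) (hqy : q y) :
    2 ≤ (D.filter q).card :=
  Finset.one_lt_card.2 ⟨x, Finset.mem_filter.2 ⟨hx, hqx⟩, y, Finset.mem_filter.2 ⟨hy, hqy⟩, hxy⟩

theorem exists_join_listColoring_one [Fintype V] (G : SimpleGraph V) {k : ℕ}
    (g : G.Coloring (Fin k)) (hk : 0 < k) (L : Fin p ⊕ V → Finset ℕ)
    (hL : IsKAssignment (p + k) L) (hp : Fintype.card V * Fintype.card V + 2 ≤ p)
    (r : Fin p ⊕ V → ℕ) (x : Fin p ⊕ V) (hx : r x ∈ L x) :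
    ∃ f : (join (⊤ : SimpleGraph (Fin p)) G).Coloring ℕ, IsListColoring L f ∧ f x = r x := by
  classical
  obtain w | v := x
  -- The class and the colour `0` are placeholders; prescribing `w` suffices.
  · obtain ⟨f, hf, hfr, -⟩ := exists_join_listColoring G g L hL ⟨0, hk⟩ 0 {w}
      (by
        rw [Finset.card_singleton]
        omega) r (by simp) (by simpa using hx)
    exact ⟨f, hf, hfr w (Finset.mem_singleton_self w)⟩
  · obtain ⟨f, hf, -, hfc⟩ := exists_join_listColoring G g L hL (g v) (r (Sum.inr v)) ∅
      (by
        rw [Finset.card_empty]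
        omega) r (by simp) (by simp)
    exact ⟨f, hf, hfc v rfl hx (by simp)⟩

theorem exists_join_listColoring_two [Fintype V] (G : SimpleGraph V) {k : ℕ} (L : Fin p ⊕ V → Finset ℕ)
    (hL : IsKAssignment (p + k) L) (hp : Fintype.card V * Fintype.card V + 3 ≤ p)
    (D : Finset (Fin p ⊕ V)) (r : Fin p ⊕ V → ℕ) (hr : IsRequest L D r)
    (hleft : D.toLeft.Nonempty) (hright : ∃ u ∈ D.toRight, ∃ v ∈ D.toRight, u ≠ v ∧
      ∃ c : G.Coloring (Fin k), c u = c v) :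
    ∃ f : (join (⊤ : SimpleGraph (Fin p)) G).Coloring ℕ, IsListColoring L f ∧
      2 ≤ (D.filter fun v => f v = r v).card := by
  classical
  obtain ⟨w, hw⟩ := hleft
  obtain ⟨u, hu, v, hv, huv, c, hc⟩ := hright
  rw [Finset.mem_toLeft] at hw
  rw [Finset.mem_toRight] at hu hv
  have hpair : ∀ x, Sum.inr x ∈ D → r (Sum.inl w) ≠ r (Sum.inr x) →
      ∃ f : (join (⊤ : SimpleGraph (Fin p)) G).Coloring ℕ, IsListColoring L f ∧
        2 ≤ (D.filter fun v => f v = r v).card := by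
    intro x hx hne
    obtain ⟨f, hf, hfr, hfc⟩ := exists_join_listColoring G c L hL (c x) (r (Sum.inr x)) {w}
      (by
        rw [Finset.card_singleton]
        omega) r (by simp) (by simpa using hr.2 _ hw)
    exact ⟨f, hf, two_le_card_filter hw hx (by simp) (hfr w (Finset.mem_singleton_self w))
      (hfc x rfl (hr.2 _ hx) (by simpa using hne))⟩
  by_cases hwu : r (Sum.inl w) = r (Sum.inr u)
  swap
  · exact hpair u hu hwu
  by_cases hwv : r (Sum.inl w) = r (Sum.inr v)
  swap
  · exact hpair v hv hwv
  -- All three requests agree: give up `w` and force the colour on the common class of `u` and `v`.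
  obtain ⟨f, hf, -, hfc⟩ := exists_join_listColoring G c L hL (c u) (r (Sum.inl w)) ∅
    (by
      rw [Finset.card_empty]
      omega) r (by simp) (by simp)
  exact ⟨f, hf, two_le_card_filter hu hv (by simpa using huv)
    ((hfc u rfl (hwu ▸ hr.2 _ hu) (by simp)).trans hwu)
    ((hfc v hc.symm (hwv ▸ hr.2 _ hv) (by simp)).trans hwv)⟩

theorem isFlexible_join [Fintype V] [Nonempty V] (G : SimpleGraph V) {k : ℕ}
    (hG : G.Colorable k) (hp : Fintype.card V * Fintype.card V + 3 ≤ p)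
    (hS : ∀ S : Finset V, S.card = G.cliqueNum + 1 → ∃ u ∈ S, ∃ v ∈ S, u ≠ v ∧
      ∃ c : G.Coloring (Fin k), c u = c v) :
    IsFlexible (join (⊤ : SimpleGraph (Fin p)) G) (p + k)
      (1 / ((p + G.cliqueNum : ℕ) : ℝ)) := by
  classical
  intro L hL D r hr
  obtain ⟨g⟩ := hG
  have hk : 0 < k := (g (Classical.arbitrary V)).pos
  have hV : Fintype.card V ≤ Fintype.card V * Fintype.card V := Nat.le_mul_self _
  by_cases hD : D.card ≤ 1 * (p + G.cliqueNum)
  · obtain ⟨x, hx⟩ := hr.1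
    obtain ⟨f, hf, hfx⟩ := exists_join_listColoring_one G g hk L hL (by omega) r x (hr.2 x hx)
    exact isSatisfiable_of_filter_card (by omega) hD f hf
      (Finset.card_pos.2 ⟨x, Finset.mem_filter.2 ⟨hx, hfx⟩⟩)
  · have h1 := D.card_toLeft_add_card_toRight
    have h2 : D.toLeft.card ≤ p := by simpa using Finset.card_le_univ D.toLeft
    have h3 := Finset.card_le_univ D.toRight
    obtain ⟨S, hSD, hScard⟩ := Finset.exists_subset_card_eq
      (s := D.toRight) (n := G.cliqueNum + 1) (by omega)
    obtain ⟨u, hu, v, hv, huv⟩ := hS S hScard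
    obtain ⟨f, hf, hf2⟩ := exists_join_listColoring_two G L hL hp D r hr
      (Finset.card_pos.1 (by omega)) ⟨u, hSD hu, v, hSD hv, huv⟩
    exact isSatisfiable_of_filter_card (by omega) (by omega) f hf hf2

theorem exists_coloring_eq_of_isFlexible_join (G : SimpleGraph V) {k : ℕ}
    (h : IsFlexible (join (⊤ : SimpleGraph (Fin p)) G) (p + k)
      (1 / ((p + G.cliqueNum : ℕ) : ℝ))) (hp : 0 < p)
    (S : Finset V) (hS : S.card = G.cliqueNum + 1) :
    ∃ u ∈ S, ∃ v ∈ S, u ≠ v ∧ ∃ c : G.Coloring (Fin k), c u = c v := by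
  classical
  set D : Finset (Fin p ⊕ V) := Finset.univ.disjSum S with hD
  have hDcard : D.card = p + (G.cliqueNum + 1) := by
    rw [hD, Finset.card_disjSum, Finset.card_univ, Fintype.card_fin, hS]
  obtain ⟨f, hf, hfD⟩ := h (fun _ => Finset.range (p + k)) (fun _ => Finset.card_range _) D
    (fun _ => 0) ⟨Finset.card_pos.1 (by omega), fun _ _ => Finset.mem_range.2 (Nat.add_pos_left hp k)⟩
  have hpos : (0 : ℝ) < ((p + G.cliqueNum : ℕ) : ℝ) := by exact_mod_cast (by omega)
  rw [one_div_mul_eq_div, div_le_iff₀ hpos, hDcard] at hfD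
  -- `D` has one vertex more than the Hall ratio, so one satisfied request is too few.
  have h2 : 1 < (D.filter fun v => f v = 0).card := by
    by_contra hcon
    have h3 : p + (G.cliqueNum + 1) ≤ (D.filter fun v => f v = 0).card * (p + G.cliqueNum) := by
      exact_mod_cast hfD
    have h4 := Nat.mul_le_mul_right (p + G.cliqueNum) (not_lt.1 hcon)
    omega
  obtain ⟨x, hx, y, hy, hxy⟩ := Finset.one_lt_card.1 h2
  simp only [Finset.mem_filter] at hx hy
  have hnadj : ¬ (join (⊤ : SimpleGraph (Fin p)) G).Adj x y := fun hadj =>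
    f.valid hadj (hx.2.trans hy.2.symm)
  have hc := (exists_coloring_of_join G f (Finset.range (p + k)) hf).2
  rw [Finset.card_range, Nat.add_sub_cancel_left] at hc
  obtain ⟨c, hc⟩ := hc
  obtain x | u := x
  · obtain y | v := y
    · exact absurd (by simpa using hxy) hnadj
    · exact absurd (join_adj_inl_inr x v) hnadj
  · obtain y | v := y
    · exact absurd (join_adj_inl_inr y u).symm hnadj
    · exact ⟨u, by simpa [hD] using hx.1, v, by simpa [hD] using hy.1, by simpa using hxy, c,
        (hc u v).2 (hx.2.trans hy.2.symm)⟩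

theorem flexOhba_iff [Finite V] [Nonempty V] (G : SimpleGraph V) :
    FlexOhba G ↔ ∀ S : Finset V, S.card = G.cliqueNum + 1 → ∃ u ∈ S, ∃ v ∈ S, u ≠ v ∧
      ∃ c : G.Coloring (Fin G.chromaticNumber.toNat), c u = c v := by
  have := Fintype.ofFinite V
  have hG : G.Colorable G.chromaticNumber.toNat := G.colorable_chromaticNumber_of_fintype
  have hk : 0 < G.chromaticNumber.toNat := (hG.some (Classical.arbitrary V)).pos
  have hV : Fintype.card V ≤ Fintype.card V * Fintype.card V := Nat.le_mul_self _
  have key : ∀ p, Fintype.card V * Fintype.card V + 3 ≤ p →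
      (listFlexNumber (join (⊤ : SimpleGraph (Fin p)) G) =
        (join (⊤ : SimpleGraph (Fin p)) G).chromaticNumber ↔
      IsFlexible (join (⊤ : SimpleGraph (Fin p)) G) (p + G.chromaticNumber.toNat)
        (1 / ((p + G.cliqueNum : ℕ) : ℝ))) := fun p hp => by
    rw [listFlexNumber_eq_chromaticNumber_iff (by omega) (chromaticNumber_join G),
      hallRatio_join G (by omega) (by omega)]
  constructor
  · rintro ⟨N, -, h⟩
    refine exists_coloring_eq_of_isFlexible_join
      (p := max N (Fintype.card V * Fintype.card V + 3)) G
      ((key _ (le_max_right _ _)).1 (h _ (le_max_left _ _))) ?_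
    exact lt_of_lt_of_le (Nat.succ_pos _) (le_max_right _ _)
  · intro h
    exact ⟨_, Nat.le_add_left 1 (Fintype.card V * Fintype.card V + 2), fun p hp =>
      (key p hp).2 (isFlexible_join G hG hp h)⟩

/-! ### A graph without the property -/

/-- The Grötzsch graph with its centre split into two vertices: the vertices `0, …, 4` form the
outer cycle, `5 + i` is the copy of `i`, and `10`, `11` are the two halves of the centre, with the
common neighbour `8`. -/
def splitGrotzsch : SimpleGraph (Fin 12) :=
  SimpleGraph.fromRel fun x y => (x.val, y.val) ∈
    [(0, 1), (1, 2), (2, 3), (3, 4), (4, 0), (5, 1), (5, 4), (6, 2), (6, 0), (7, 3), (7, 1),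
      (8, 4), (8, 2), (9, 0), (9, 3), (10, 5), (10, 6), (10, 8), (11, 7), (11, 8), (11, 9)]

instance : DecidableRel splitGrotzsch.Adj := fun x y => by
  unfold splitGrotzsch
  infer_instance

theorem splitGrotzsch_colorable : splitGrotzsch.Colorable 3 :=
  ⟨SimpleGraph.Coloring.mk ![0, 1, 0, 1, 2, 0, 1, 2, 1, 2, 2, 0] (by decide +kernel)⟩

theorem splitGrotzsch_cliqueNum : splitGrotzsch.cliqueNum = 2 := by
  refine le_antisymm ?_ ?_
  · obtain ⟨s, hs⟩ := splitGrotzsch.exists_isNClique_cliqueNum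
    by_contra hcon
    have h3 : ∀ a b c, splitGrotzsch.Adj a b → splitGrotzsch.Adj a c →
      ¬ splitGrotzsch.Adj b c := by decide +kernel
    obtain ⟨a, ha, b, hb, c, hc, hab, hac, hbc⟩ := Finset.two_lt_card.1
      (by rw [hs.card_eq]; omega : 2 < s.card)
    exact h3 a b c (hs.isClique ha hb hab) (hs.isClique ha hc hac) (hs.isClique hb hc hbc)
  · have h01 : splitGrotzsch.IsClique ({0, 1} : Finset (Fin 12)) := by
      rw [Finset.coe_pair, SimpleGraph.isClique_pair]
      exact fun _ => by decide +kernel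
    exact h01.card_le_cliqueNum

theorem pentagon_no_two_coloring (a c₀ c₁ c₂ c₃ c₄ : Fin 3) (h₀ : c₀ ≠ a) (h₁ : c₁ ≠ a)
    (h₂ : c₂ ≠ a) (h₃ : c₃ ≠ a) (h₄ : c₄ ≠ a) (h₀₁ : c₀ ≠ c₁) (h₁₂ : c₁ ≠ c₂) (h₂₃ : c₂ ≠ c₃)
    (h₃₄ : c₃ ≠ c₄) (h₄₀ : c₄ ≠ c₀) : False := by
  omega

/-- Mycielski's argument: if the two halves agreed, recolouring each outer vertex that has the
centre's colour with the colour of its copy would 2-colour the pentagon. -/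
theorem splitGrotzsch_coloring_ne (c : splitGrotzsch.Coloring (Fin 3)) : c 10 ≠ c 11 := by
  intro h
  have e : ∀ x y, splitGrotzsch.Adj x y → c x ≠ c y := fun x y hxy => c.valid hxy
  have h5 := e 10 5 (by decide +kernel)
  have h6 := e 10 6 (by decide +kernel)
  have h7 := h ▸ e 11 7 (by decide +kernel)
  have h8 := e 10 8 (by decide +kernel)
  have h9 := h ▸ e 11 9 (by decide +kernel)
  have hcyc : ∀ x y x' y', splitGrotzsch.Adj x y → splitGrotzsch.Adj x y' →
      splitGrotzsch.Adj x' y → c 10 ≠ c x' → c 10 ≠ c y' →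
      (if c x = c 10 then c x' else c x) ≠ (if c y = c 10 then c y' else c y) := by
    intro x y x' y' h1 h2 h3 h4 h5
    have := e x y h1
    have := e x y' h2
    have := e x' y h3
    split_ifs <;> simp_all
  have hne : ∀ x x', c 10 ≠ c x' → (if c x = c 10 then c x' else c x) ≠ c 10 := by
    intro x x' h1
    split_ifs with h2
    · exact h1.symm
    · exact h2
  exact pentagon_no_two_coloring (c 10) _ _ _ _ _ (hne 0 5 h5) (hne 1 6 h6) (hne 2 7 h7)
    (hne 3 8 h8) (hne 4 9 h9)
    (hcyc 0 1 5 6 (by decide +kernel) (by decide +kernel) (by decide +kernel) h5 h6)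
    (hcyc 1 2 6 7 (by decide +kernel) (by decide +kernel) (by decide +kernel) h6 h7)
    (hcyc 2 3 7 8 (by decide +kernel) (by decide +kernel) (by decide +kernel) h7 h8)
    (hcyc 3 4 8 9 (by decide +kernel) (by decide +kernel) (by decide +kernel) h8 h9)
    (hcyc 4 0 9 5 (by decide +kernel) (by decide +kernel) (by decide +kernel) h9 h5)

theorem not_flexOhba_splitGrotzsch : ¬ FlexOhba splitGrotzsch := by
  rw [flexOhba_iff]
  intro h
  obtain ⟨u, hu, v, hv, huv, c, hc⟩ := h {8, 10, 11} (by rw [splitGrotzsch_cliqueNum]; rfl)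
  -- The upper bound is enough: a colouring with fewer colours is also a 3-colouring. In `{8, 10,
  -- 11}` the vertex `8` is adjacent to both halves, which never share a colour.
  have hle : splitGrotzsch.chromaticNumber.toNat ≤ 3 :=
    ENat.toNat_le_of_le_natCast splitGrotzsch_colorable.chromaticNumber_le
  set d : splitGrotzsch.Coloring (Fin 3) := SimpleGraph.Coloring.mk
    (fun x => Fin.castLE hle (c x)) fun {x y} hxy e => c.valid hxy (Fin.castLE_injective hle e)
    with hd
  have hduv : d u = d v := congrArg (Fin.castLE hle) hc
  have h8 : d 8 ≠ d 10 := d.valid (by decide +kernel)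
  have h9 : d 8 ≠ d 11 := d.valid (by decide +kernel)
  have h10 := splitGrotzsch_coloring_ne d
  simp only [Finset.mem_insert, Finset.mem_singleton] at hu hv
  obtain rfl | rfl | rfl := hu <;> obtain rfl | rfl | rfl := hv <;>
    first | exact huv rfl | exact h8 hduv | exact h8 hduv.symm | exact h9 hduv |
      exact h9 hduv.symm | exact h10 hduv | exact h10 hduv.symm

end FlexList

theorem mainTheorem1 :
    (∀ (V : Type*) [Finite V] [Nonempty V] (G : SimpleGraph V),
      FlexList.FlexOhba G ↔
        ∀ S : Finset V, S.card = G.cliqueNum + 1 →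
          ∃ u ∈ S, ∃ v ∈ S, u ≠ v ∧
            ∃ c : G.Coloring (Fin G.chromaticNumber.toNat), c u = c v) ∧
    (∃ n : ℕ, 0 < n ∧ ∃ G : SimpleGraph (Fin n), ¬ FlexList.FlexOhba G) :=
  ⟨fun _ _ _ G => FlexList.flexOhba_iff G, 12, by norm_num, FlexList.splitGrotzsch,
    FlexList.not_flexOhba_splitGrotzsch⟩
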